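/- Let $A$ be a complex abelian variety, written as $A(\mathbb C)=W/\Lambda$ with $W=\mathrm{Lie}(A)$ a finite-dimensional complex vector space and $\Lambda=H_1(A(\mathbb C),\mathbb Z)\subset W$ a full lattice admitting a Riemann form (for instance $A=A_0\otimes_{k_0}\mathbb C$ for an abelian variety $A_0$ over a number field $k_0\subset\mathbb C$). Put $V=\Lambda\otimes\mathbb Q=H_1(A(\mathbb C),\mathbb Q)$, with Hodge decomposition $V\otimes\mathbb C=V^{-1,0}\oplus V^{0,-1}$, where $V^{0,-1}=\ker(V\otimes\mathbb C\to W)$ and $V^{-1,0}=\overline{V^{0,-1}}$. The Hodge cocharacter $\mu:\mathbb C^\times\to \mathrm{GL}(V\otimes\mathbb C)$ lets $\mu(z)$ act as $z$ on $V^{-1,0}$ and as $1$ on $V^{0,-1}$, and the Mumford–Tate group $MT(A)$ is the smallest algebraic $\mathbb Q$-subgroup $G$ of $\mathrm{GL}(V)$ such that $G(\mathbb C)\supset\mu(\mathbb C^\times)$. Let $K$ be a CM field and $\Phi\subset\Sigma_K:=\mathrm{Hom}(K,\mathbb C)$ a CM type, i.e. the complement of $\Phi$ in $\Sigma_K$ is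 the complex conjugate of $\Phi$. Suppose that $A$ is of CM type $(K,\Phi)$: there is given a ring monomorphism $i:K\to \mathrm{End}(A)\otimes\mathbb Q$, one has $2\dim A=[K:\mathbb Q]$, and the character of the representation of $K$ on $\mathrm{Lie}(A)$ is $\sum_{\varphi\in\Phi}\varphi$. For a number field $F$ let $T^F=\mathrm{Res}_{F/\mathbb Q}\mathbb G_{m,F}$, so that $T^F(R)=(R\otimes_{\mathbb Q}F)^\times$ for every $\mathbb Q$-algebra $R$; through $i$, the torus $T^K$ is regarded as an algebraic $\mathbb Q$-subgroup of $\mathrm{GL}(V)$. Let $k$ be any number field which is an extension of $K$, is Galois over $\mathbb Q$, and is equipped with an embedding into $\mathbb C$; identify $\mathrm{Gal}(k/\mathbb Q)$ with $\Sigma_k$ by means of this embedding, and let $\Sigma_K$ and the restriction map $\Sigma_k\to\Sigma_K$ be as usual. Put $\Phi_k=\{\sigma\in \mathrm{Gal}(k/\mathbb Q) : \sigma|_K\in\Phi\}$. The homomorphism $N_{\Phi_k^{-1}}=\prod_{\sigma\in\Phi_k^{-1}}\sigma: T^k\to T^k$ factors through the subtorus $T^K\subset T^k$; let $\psi:T^k\to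 T^K$ be the resulting (reflex norm) homomorphism, and let $T_0=\psi(T^k)\subset T^K$ be its image. Then, as algebraic $\mathbb Q$-subgroups of $\mathrm{GL}(V)$, $$MT(A)=T_0 .$$ -/

import Mathlib

open scoped TensorProduct

noncomputable section

namespace CMAV

universe u v w r

/-! ## Complex abelian varieties -/

/-- A complex abelian variety `A` with Lie algebra `W`, given through its complex uniformization
`A(ℂ) = W / Λ`: a full lattice `Λ` in the finite-dimensional complex vector space `W`
such that the complex torus `W / Λ` admits a Riemann form (a polarization). -/
structure AbelianVariety (W : Type u) [NormedAddCommGroup W] [NormedSpace ℂ W]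
    [FiniteDimensional ℂ W] where
  /-- the lattice `Λ = H₁(A(ℂ), ℤ)` -/
  lattice : Submodule ℤ W
  discrete : DiscreteTopology lattice
  isZLattice : IsZLattice ℝ lattice
  /-- existence of a Riemann form -/
  polarizable : ∃ E : W →ₗ[ℝ] W →ₗ[ℝ] ℝ,
    (∀ x, E x x = 0) ∧
    (∀ x ∈ lattice, ∀ y ∈ lattice, ∃ n : ℤ, E x y = n) ∧
    (∀ x y, E (Complex.I • x) (Complex.I • y) = E x y) ∧
    (∀ x, x ≠ 0 → 0 < E (Complex.I • x) x)

namespace AbelianVariety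

variable {W : Type u} [NormedAddCommGroup W] [NormedSpace ℂ W] [FiniteDimensional ℂ W]
  (A : AbelianVariety W)

instance : DiscreteTopology A.lattice := A.discrete

instance : IsZLattice ℝ A.lattice := A.isZLattice

/-- `V = H₁(A(ℂ), ℚ) = Λ ⊗ ℚ`. -/
abbrev H1 : Type u := ℚ ⊗[ℤ] A.lattice

/-- `V_ℂ = V ⊗ ℂ = H₁(A(ℂ), ℂ)`. -/
abbrev H1C : Type u := ℂ ⊗[ℚ] A.H1

/-! ### Endomorphisms -/

/-- The endomorphism ring `End(A)`: the `ℂ`-linear endomorphisms of the Lie algebra that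
preserve the lattice. -/
def endRing : Subring (Module.End ℂ W) where
  carrier := {f | ∀ x ∈ A.lattice, f x ∈ A.lattice}
  mul_mem' := fun hf hg x hx => hf _ (hg x hx)
  one_mem' := fun _ hx => hx
  add_mem' := fun hf hg x hx => A.lattice.add_mem (hf x hx) (hg x hx)
  zero_mem' := fun _ _ => A.lattice.zero_mem
  neg_mem' := fun hf x hx => A.lattice.neg_mem (hf x hx)

/-- The endomorphism algebra `End⁰(A) = End(A) ⊗ ℚ`. -/
abbrev End0 : Type u := ℚ ⊗[ℤ] A.endRing

/-- The action of `End(A)` on `Λ = H₁(A(ℂ), ℤ)`. -/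
def endLattice : A.endRing →+* Module.End ℤ A.lattice where
  toFun f := (f.1.restrictScalars ℤ).restrict f.2
  map_one' := rfl
  map_mul' _ _ := rfl
  map_zero' := rfl
  map_add' _ _ := rfl

/-- The action of `End⁰(A)` on `V = H₁(A(ℂ), ℚ)`: the element `q ⊗ f` acts as `q • H₁(f)`. -/
def actH1 : A.End0 →ₐ[ℚ] Module.End ℚ A.H1 :=
  Algebra.TensorProduct.lift (Algebra.ofId ℚ _)
    ((Module.End.baseChangeHom ℤ ℚ A.lattice).comp A.endLattice.toIntAlgHom)
    (fun q _ => Algebra.commutes q _)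

/-- The action of `End⁰(A)` on the Lie algebra `W`: the element `q ⊗ f` acts as `q • Lie(f)`. -/
def actLie : A.End0 →+* Module.End ℂ W :=
  (Algebra.TensorProduct.lift (R := ℤ) (S := ℤ)
    ((algebraMap ℂ (Module.End ℂ W)).comp (algebraMap ℚ ℂ)).toIntAlgHom
    A.endRing.subtype.toIntAlgHom
    (fun q _ => Algebra.commutes (algebraMap ℚ ℂ q) _)).toRingHom

theorem actH1_tmul (q q' : ℚ) (f : A.endRing) (x : A.lattice) :
    A.actH1 (q ⊗ₜ f) (q' ⊗ₜ x) = (q * q') ⊗ₜ (⟨f.1 x, f.2 x x.2⟩ : A.lattice) := by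
  simp [actH1, endLattice, Module.End.baseChangeHom, Algebra.ofId_apply]
  rfl

theorem actLie_tmul (q : ℚ) (f : A.endRing) (w : W) : A.actLie (q ⊗ₜ f) w = (q : ℂ) • f.1 w := by
  have h : A.actLie (q ⊗ₜ f) = algebraMap ℂ (Module.End ℂ W) (q : ℂ) * f.1 :=
    Algebra.TensorProduct.lift_tmul _ _ _ _ _
  rw [h]
  rfl

/-! ### The Hodge decomposition and the Hodge cocharacter -/

/-- The period map `V_ℂ → Lie(A) = W`: the `ℂ`-linear extension `c ⊗ (q ⊗ x) ↦ (c q) • x` of the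
inclusion `Λ ⊆ W`. -/
def period : A.H1C →ₗ[ℂ] W :=
  (LinearMap.liftBaseChange ℂ A.lattice.subtype) ∘ₗ
    (TensorProduct.AlgebraTensorModule.cancelBaseChange ℤ ℚ ℂ ℂ A.lattice).toLinearMap

theorem period_tmul (c : ℂ) (q : ℚ) (x : A.lattice) :
    A.period (c ⊗ₜ (q ⊗ₜ x)) = ((q : ℂ) * c) • (x : W) := by
  simp [period, Rat.smul_def]

/-- Complex conjugation on `V_ℂ`: `c ⊗ v ↦ conj c ⊗ v`. -/
def conj : A.H1C →ₗ[ℚ] A.H1C :=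
  LinearMap.rTensor A.H1 (Complex.conjAe.toLinearMap.restrictScalars ℚ)

theorem conj_tmul (c : ℂ) (v : A.H1) : A.conj (c ⊗ₜ v) = (starRingEnd ℂ c) ⊗ₜ v := rfl

theorem conj_smul (c : ℂ) (x : A.H1C) : A.conj (c • x) = (starRingEnd ℂ c) • A.conj x := by
  induction x using TensorProduct.induction_on with
  | zero => simp
  | add x y hx hy => simp only [smul_add, map_add, hx, hy]
  | tmul a v => simp [TensorProduct.smul_tmul', conj_tmul]

/-- The Hodge piece `V^{0,-1} = F⁰ V_ℂ`: the kernel of the period map `V_ℂ → Lie(A)`. -/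
def hodgeZero : Submodule ℂ A.H1C := LinearMap.ker A.period

/-- The Hodge piece `V^{-1,0}`: the complex conjugate of `V^{0,-1}`.  The period map sends it
isomorphically onto `Lie(A)`. -/
def hodgeMinusOne : Submodule ℂ A.H1C where
  carrier := {x | A.conj x ∈ A.hodgeZero}
  zero_mem' := by simp
  add_mem' := fun {x y} hx hy => by
    simpa only [Set.mem_ofPred_eq, map_add] using A.hodgeZero.add_mem hx hy
  smul_mem' := fun c x hx => by
    simpa only [Set.mem_ofPred_eq, conj_smul] using A.hodgeZero.smul_mem (starRingEnd ℂ c) hx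

theorem mem_hodgeZero {x : A.H1C} : x ∈ A.hodgeZero ↔ A.period x = 0 := Iff.rfl

theorem mem_hodgeMinusOne {x : A.H1C} : x ∈ A.hodgeMinusOne ↔ A.period (A.conj x) = 0 := Iff.rfl

/-- A real section of the period map. -/
theorem exists_section : ∃ s : W →ₗ[ℝ] A.H1C, (∀ x, A.period (s x) = x) ∧
    (∀ x, A.conj (s x) = s x) ∧
    (∀ v : A.H1C, ∃ x y : W, v = s x + Complex.I • s y) := by
  have : Module.Finite ℤ A.lattice := ZLattice.module_finite ℝ A.lattice
  have : Module.Free ℤ A.lattice := ZLattice.module_free ℝ A.lattice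
  let b := Module.Free.chooseBasis ℤ A.lattice
  let B := b.ofZLatticeBasis ℝ A.lattice
  have hB : ∀ i, B i = (b i : W) := b.ofZLatticeBasis_apply ℝ A.lattice
  let s : W →ₗ[ℝ] A.H1C := B.constr ℝ (fun i => (1 : ℂ) ⊗ₜ[ℚ] ((1 : ℚ) ⊗ₜ[ℤ] b i))
  have hs : ∀ i, s (B i) = (1 : ℂ) ⊗ₜ[ℚ] ((1 : ℚ) ⊗ₜ[ℤ] b i) := fun i => B.constr_basis ℝ _ i
  have key : ∀ (x : W), s x = ∑ i, ((B.repr x i : ℝ) : ℂ) • ((1 : ℂ) ⊗ₜ[ℚ] ((1 : ℚ) ⊗ₜ[ℤ] b i)) := by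
    intro x
    conv_lhs => rw [← B.sum_repr x]
    simp only [map_sum, map_smul, hs]
    rfl
  refine ⟨s, fun x => ?_, fun x => ?_, fun v => ?_⟩
  · rw [key]
    conv_rhs => rw [← B.sum_repr x]
    simp only [map_sum, map_smul, period_tmul, hB]
    simp
  · rw [key]
    simp only [map_sum, conj_smul, conj_tmul, Complex.conj_ofReal, map_one]
  · have hL : ∀ z : A.lattice, s (z : W) = (1 : ℂ) ⊗ₜ[ℚ] ((1 : ℚ) ⊗ₜ[ℤ] z) := by
      intro z
      rw [key, ← b.sum_repr z]
      simp only [TensorProduct.tmul_sum]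
      refine Finset.sum_congr rfl fun i _ => ?_
      rw [b.sum_repr z, b.ofZLatticeBasis_repr_apply ℝ A.lattice z i]
      have e : (1 : ℚ) ⊗ₜ[ℤ] (b.repr z i • b i)
          = ((b.repr z i : ℤ) : ℚ) • ((1 : ℚ) ⊗ₜ[ℤ] b i) := by
        rw [TensorProduct.tmul_smul, Int.cast_smul_eq_zsmul]
      rw [e, TensorProduct.tmul_smul, Int.cast_smul_eq_zsmul, Complex.ofReal_intCast,
        Int.cast_smul_eq_zsmul]
    induction v using TensorProduct.induction_on with
    | zero => exact ⟨0, 0, by simp⟩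
    | add v w hv hw =>
      obtain ⟨x, y, rfl⟩ := hv
      obtain ⟨x', y', rfl⟩ := hw
      exact ⟨x + x', y + y', by simp only [map_add, smul_add]; abel⟩
    | tmul c v =>
      induction v using TensorProduct.induction_on with
      | zero => exact ⟨0, 0, by simp⟩
      | add v w hv hw =>
        obtain ⟨x, y, h⟩ := hv
        obtain ⟨x', y', h'⟩ := hw
        exact ⟨x + x', y + y', by
          rw [TensorProduct.tmul_add, h, h']; simp only [map_add, smul_add]; abel⟩
      | tmul q z =>
        refine ⟨((q : ℝ) * c.re) • (z : W), ((q : ℝ) * c.im) • (z : W), ?_⟩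
        have e : (c ⊗ₜ[ℚ] (q ⊗ₜ[ℤ] z) : A.H1C)
            = ((q : ℂ) * c) • ((1 : ℂ) ⊗ₜ[ℚ] ((1 : ℚ) ⊗ₜ[ℤ] z)) := by
          have : (q ⊗ₜ[ℤ] z : A.H1) = q • ((1 : ℚ) ⊗ₜ[ℤ] z) := by simp [TensorProduct.smul_tmul']
          rw [this, ← TensorProduct.smul_tmul, TensorProduct.smul_tmul']
          simp [Rat.smul_def]
        rw [e, map_smul, map_smul, hL]
        conv_lhs => rw [← Complex.re_add_im c]
        have hr : ∀ t : ℝ, t • ((1 : ℂ) ⊗ₜ[ℚ] ((1 : ℚ) ⊗ₜ[ℤ] z) : A.H1C)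
            = (t : ℂ) • ((1 : ℂ) ⊗ₜ[ℚ] ((1 : ℚ) ⊗ₜ[ℤ] z)) := fun t => rfl
        rw [hr, hr, smul_smul, ← add_smul]
        congr 1
        push_cast
        ring

/-- The Hodge decomposition `V_ℂ = V^{-1,0} ⊕ V^{0,-1}`. -/
theorem isCompl_hodge : IsCompl A.hodgeMinusOne A.hodgeZero := by
  obtain ⟨s, h1, h2, h3⟩ := A.exists_section
  have cI : ∀ y : W, A.conj (Complex.I • s y) = -(Complex.I • s y) := fun y => by
    rw [conj_smul, h2, Complex.conj_I, neg_smul]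
  refine IsCompl.of_eq ?_ ?_
  · rw [Submodule.eq_bot_iff]
    rintro v ⟨hv1, hv0⟩
    obtain ⟨x, y, rfl⟩ := h3 v
    have e0 : x + Complex.I • y = 0 := by
      have := A.mem_hodgeZero.1 hv0
      rwa [map_add, map_smul, h1, h1] at this
    have e1 : x - Complex.I • y = 0 := by
      have := A.mem_hodgeMinusOne.1 hv1
      rwa [map_add, cI, h2, map_add, map_neg, map_smul, h1, h1, ← sub_eq_add_neg] at this
    have ex : x = 0 := by
      have : (2 : ℂ) • x = 0 := by
        rw [two_smul]
        calc x + x = (x + Complex.I • y) + (x - Complex.I • y) := by abel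
          _ = 0 := by rw [e0, e1, add_zero]
      simpa using this
    have ey : y = 0 := by simpa [ex] using e0
    simp [ex, ey]
  · rw [Submodule.eq_top_iff']
    intro v
    let w := A.period v
    let p : A.H1C := (1 / 2 : ℂ) • (s w - Complex.I • s (Complex.I • w))
    have hp : A.period p = w := by
      simp only [p, map_smul, map_sub, h1, smul_smul, Complex.I_mul_I, neg_one_smul, sub_neg_eq_add]
      rw [← two_smul ℂ w, smul_smul]
      norm_num
    have hp1 : p ∈ A.hodgeMinusOne := by
      rw [mem_hodgeMinusOne]
      have e : A.conj (s w - Complex.I • s (Complex.I • w)) = s w + Complex.I • s (Complex.I • w) := by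
        rw [map_sub, h2, cI, sub_neg_eq_add]
      rw [conj_smul, e, map_smul, map_add, map_smul, h1, h1, smul_smul, Complex.I_mul_I,
        neg_one_smul, add_neg_cancel, smul_zero]
    refine Submodule.mem_sup.2 ⟨p, hp1, v - p, ?_, by abel⟩
    rw [mem_hodgeZero, map_sub, hp, sub_self]

/-- `GL(V)(ℂ) = GL(V_ℂ)`. -/
abbrev GLC : Type u := LinearMap.GeneralLinearGroup ℂ A.H1C

/-- The endomorphism of `V_ℂ` acting as `z` on `V^{-1,0}` and as `1` on `V^{0,-1}`. -/
def hodgeEnd (z : ℂ) : Module.End ℂ A.H1C :=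
  z • A.hodgeMinusOne.projection A.hodgeZero A.isCompl_hodge +
    A.hodgeZero.projection A.hodgeMinusOne A.isCompl_hodge.symm

theorem hodgeEnd_of_mem_minusOne (z : ℂ) {x : A.H1C} (hx : x ∈ A.hodgeMinusOne) :
    A.hodgeEnd z x = z • x := by
  have h0 : A.hodgeZero.projection A.hodgeMinusOne A.isCompl_hodge.symm x = 0 :=
    (Submodule.projection_apply_eq_zero_iff _).2 hx
  rw [hodgeEnd, LinearMap.add_apply, LinearMap.smul_apply,
    Submodule.projection_apply_of_mem_left _ hx, h0, add_zero]

theorem hodgeEnd_of_mem_zero (z : ℂ) {x : A.H1C} (hx : x ∈ A.hodgeZero) :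
    A.hodgeEnd z x = x := by
  have h0 : A.hodgeMinusOne.projection A.hodgeZero A.isCompl_hodge x = 0 :=
    (Submodule.projection_apply_eq_zero_iff _).2 hx
  rw [hodgeEnd, LinearMap.add_apply, LinearMap.smul_apply,
    Submodule.projection_apply_of_mem_left _ hx, h0, smul_zero, zero_add]

theorem hodge_ext {f g : Module.End ℂ A.H1C} (h1 : ∀ x ∈ A.hodgeMinusOne, f x = g x)
    (h0 : ∀ x ∈ A.hodgeZero, f x = g x) : f = g := by
  refine LinearMap.ext fun x => ?_
  have hx : x ∈ A.hodgeMinusOne ⊔ A.hodgeZero := by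
    rw [A.isCompl_hodge.sup_eq_top]; trivial
  obtain ⟨y, hy, z, hz, rfl⟩ := Submodule.mem_sup.1 hx
  rw [map_add, map_add, h1 y hy, h0 z hz]

/-- `hodgeEnd` as a monoid homomorphism. -/
def hodgeHom : ℂ →* Module.End ℂ A.H1C where
  toFun := A.hodgeEnd
  map_one' := A.hodge_ext (fun x hx => by simp [A.hodgeEnd_of_mem_minusOne 1 hx])
    (fun x hx => by simp [A.hodgeEnd_of_mem_zero 1 hx])
  map_mul' z w := A.hodge_ext
    (fun x hx => by
      rw [Module.End.mul_apply, A.hodgeEnd_of_mem_minusOne w hx, map_smul,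
        A.hodgeEnd_of_mem_minusOne z hx, A.hodgeEnd_of_mem_minusOne _ hx, smul_smul, mul_comm])
    (fun x hx => by
      rw [Module.End.mul_apply, A.hodgeEnd_of_mem_zero w hx, A.hodgeEnd_of_mem_zero z hx,
        A.hodgeEnd_of_mem_zero _ hx])

/-- The Hodge cocharacter `μ : ℂˣ → GL(V_ℂ)`: `μ(z)` acts as `z` on `V^{-1,0}`
and trivially on `V^{0,-1}`. -/
def hodgeCochar : ℂˣ →* A.GLC := Units.map A.hodgeHom

/-! ### The Mumford–Tate group -/

/-- The matrix coefficient `g ↦ ⟨ℓ, g v⟩` of `g ∈ GL(V_ℂ)` for `ℓ ∈ V^∨`, `v ∈ V`. -/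
def matrixCoeff (g : A.GLC) (p : Module.Dual ℚ A.H1 × A.H1) : ℂ :=
  TensorProduct.rid ℚ ℂ (LinearMap.baseChange ℂ p.1 (g.1 ((1 : ℂ) ⊗ₜ[ℚ] p.2)))

/-- `G` is (the group of complex points of) an algebraic `ℚ`-subgroup of `GL(V)`: it is the
locus in `GL(V_ℂ)` where a set of polynomials with rational coefficients in the matrix
coefficients of `V` vanishes. -/
def IsAlgebraicSubgroup (G : Subgroup A.GLC) : Prop :=
  ∃ S : Set (MvPolynomial (Module.Dual ℚ A.H1 × A.H1) ℚ),
    ∀ g : A.GLC, g ∈ G ↔ ∀ f ∈ S, MvPolynomial.aeval (A.matrixCoeff g) f = 0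

/-- The Mumford–Tate group `MT(A)` (its group of complex points): the smallest algebraic
`ℚ`-subgroup `G` of `GL(V)` such that `G(ℂ)` contains the image of the Hodge cocharacter. -/
def mumfordTate : Subgroup A.GLC :=
  sInf {G | A.IsAlgebraicSubgroup G ∧ A.hodgeCochar.range ≤ G}

theorem isLeast_mumfordTate :
    IsLeast {G | A.IsAlgebraicSubgroup G ∧ A.hodgeCochar.range ≤ G} A.mumfordTate := by
  refine ⟨⟨?_, le_sInf fun G hG => hG.2⟩, fun G hG => sInf_le hG⟩
  refine ⟨{f | ∃ (G : Subgroup A.GLC) (S : Set (MvPolynomial (Module.Dual ℚ A.H1 × A.H1) ℚ)),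
    (∀ g : A.GLC, g ∈ G ↔ ∀ f ∈ S, MvPolynomial.aeval (A.matrixCoeff g) f = 0) ∧
      A.hodgeCochar.range ≤ G ∧ f ∈ S}, fun g => ?_⟩
  rw [mumfordTate, Subgroup.mem_sInf]
  constructor
  · rintro h f ⟨G, S, hS, hG, hf⟩
    exact (hS g).1 (h G ⟨⟨S, hS⟩, hG⟩) f hf
  · rintro h G ⟨⟨S, hS⟩, hG⟩
    exact (hS g).2 fun f hf => h f ⟨G, S, hS, hG, hf⟩

end AbelianVariety

/-! ## Tori, CM types and the reflex norm -/

/-- The `R`-points `T^F(R) = (R ⊗ F)ˣ` of the torus `T^F = Res_{F/ℚ} 𝔾_m`. -/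
abbrev Torus (F : Type v) [Field F] [NumberField F] (R : Type r) [CommRing R] [Algebra ℚ R] :
    Type (max v r) := (R ⊗[ℚ] F)ˣ

section CM

variable {K : Type v} {k : Type w} [Field K] [NumberField K] [Field k] [NumberField k] [Algebra K k]

/-- `Φ` is a CM type of `K`: the complement of `Φ` in the set of complex embeddings of `K` is
the complex conjugate of `Φ`. -/
def IsCMType (Φ : Finset (K →+* ℂ)) : Prop :=
  ∀ φ : K →+* ℂ, φ ∉ Φ ↔ NumberField.ComplexEmbedding.conjugate φ ∈ Φ

open Classical in
/-- The set `Φ_k` of embeddings of `k` whose restriction to `K` is in `Φ`; here `k / ℚ` is Galois,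
embedded in `ℂ` by `ι`, and `σ ∈ Gal(k/ℚ)` is identified with the embedding `ι ∘ σ`. -/
def extendedType [IsGalois ℚ k] (ι : k →+* ℂ) (Φ : Finset (K →+* ℂ)) : Finset (k ≃ₐ[ℚ] k) :=
  Finset.univ.filter fun σ => (ι.comp (σ : k →+* k)).comp (algebraMap K k) ∈ Φ

variable (R : Type r) [CommRing R] [Algebra ℚ R]

/-- The automorphism of the torus `T^k` induced by `σ ∈ Gal(k/ℚ)`, on `R`-points. -/
def torusGal (σ : k ≃ₐ[ℚ] k) : Torus k R →* Torus k R :=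
  Units.map (Algebra.TensorProduct.map (AlgHom.id ℚ R) (σ : k →ₐ[ℚ] k) : R ⊗[ℚ] k →* R ⊗[ℚ] k)

/-- The endomorphism `N_{Φ_k⁻¹} = ∏_{σ ∈ Φ_k⁻¹} σ` of the torus `T^k`, on `R`-points. -/
def typeNorm [IsGalois ℚ k] (ι : k →+* ℂ) (Φ : Finset (K →+* ℂ)) : Torus k R →* Torus k R :=
  ∏ σ ∈ extendedType ι Φ, torusGal R σ⁻¹

variable (K k) in
/-- The inclusion `R ⊗ K → R ⊗ k`. -/
def tensorIncl : R ⊗[ℚ] K →ₐ[ℚ] R ⊗[ℚ] k :=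
  Algebra.TensorProduct.map (AlgHom.id ℚ R) (algebraMap K k).toRatAlgHom

variable (K k) in
/-- The inclusion of tori `T^K ⊆ T^k`, on `R`-points. -/
def torusIncl : Torus K R →* Torus k R := Units.map (tensorIncl K k R : R ⊗[ℚ] K →* R ⊗[ℚ] k)

theorem torusIncl_injective : Function.Injective (torusIncl K k R) := by
  apply Units.map_injective
  exact Module.Flat.lTensor_preserves_injective_linearMap (M := R)
    (algebraMap K k).toRatAlgHom.toLinearMap (algebraMap K k).injective

/-- Descent: an element of `R ⊗ k` fixed by `Gal(k/K)` comes from `R ⊗ K`. -/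
theorem mem_range_of_fixed [IsGalois ℚ k] (y : R ⊗[ℚ] k)
    (hy : ∀ h : k ≃ₐ[K] k, Algebra.TensorProduct.map (AlgHom.id ℚ R)
      ((h.restrictScalars ℚ : k ≃ₐ[ℚ] k) : k →ₐ[ℚ] k) y = y) :
    y ∈ (tensorIncl K k R).range := by
  have : IsGalois K k := IsGalois.tower_top_of_isGalois ℚ K k
  have : FiniteDimensional K k := Module.Finite.of_restrictScalars_finite ℚ K k
  have avg : ∀ x : R ⊗[ℚ] k, (∑ h : k ≃ₐ[K] k, Algebra.TensorProduct.map (AlgHom.id ℚ R)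
      ((h.restrictScalars ℚ : k ≃ₐ[ℚ] k) : k →ₐ[ℚ] k) x) ∈ (tensorIncl K k R).range := by
    intro x
    induction x with
    | zero => simp
    | add x y hx hy =>
      simp only [map_add, Finset.sum_add_distrib]
      exact add_mem hx hy
    | tmul r a =>
      refine ⟨r ⊗ₜ Algebra.trace K k a, ?_⟩
      have : algebraMap K k (Algebra.trace K k a) = ∑ h : k ≃ₐ[K] k, h a :=
        trace_eq_sum_automorphisms a
      simp only [Algebra.TensorProduct.map_tmul, ← TensorProduct.tmul_sum]
      simpa [tensorIncl] using congrArg (fun t => r ⊗ₜ[ℚ] t) this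
  have h := avg y
  simp only [hy, Finset.sum_const, Finset.card_univ] at h
  have h2 := Subalgebra.smul_mem _ h ((Fintype.card (k ≃ₐ[K] k) : ℚ)⁻¹)
  rw [← Nat.cast_smul_eq_nsmul ℚ, smul_smul, inv_mul_cancel₀, one_smul] at h2
  · exact h2
  · exact_mod_cast Fintype.card_ne_zero

theorem torusGal_mul (σ τ : k ≃ₐ[ℚ] k) (x : Torus k R) :
    torusGal R (σ * τ) x = torusGal R σ (torusGal R τ x) := by
  ext
  change Algebra.TensorProduct.map (AlgHom.id ℚ R) _ x.1 =
    Algebra.TensorProduct.map (AlgHom.id ℚ R) _ (Algebra.TensorProduct.map (AlgHom.id ℚ R) _ x.1)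
  induction x.1 with
  | zero => simp
  | add a b ha hb => simp only [map_add, ha, hb]
  | tmul r a => simp

theorem typeNorm_apply [IsGalois ℚ k] (ι : k →+* ℂ) (Φ : Finset (K →+* ℂ)) (x : Torus k R) :
    typeNorm R ι Φ x = ∏ σ ∈ extendedType ι Φ, torusGal R σ⁻¹ x := by
  simp [typeNorm]

/-- `N_{Φ_k⁻¹}` factors through the subtorus `T^K ⊆ T^k`. -/
theorem typeNorm_mem_range [IsGalois ℚ k] (ι : k →+* ℂ) (Φ : Finset (K →+* ℂ)) (x : Torus k R) :
    typeNorm R ι Φ x ∈ (torusIncl K k R).range := by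
  have fixed : ∀ (x : Torus k R) (h : k ≃ₐ[K] k),
      torusGal R (h.restrictScalars ℚ) (typeNorm R ι Φ x) = typeNorm R ι Φ x := by
    intro x h
    rw [typeNorm_apply, map_prod]
    refine Finset.prod_bij' (fun σ _ => σ * (h.restrictScalars ℚ)⁻¹)
      (fun σ _ => σ * (h.restrictScalars ℚ)) ?_ ?_ ?_ ?_ ?_
    · intro σ hσ
      simp only [extendedType, Finset.mem_filter, Finset.mem_univ, true_and] at hσ ⊢
      convert hσ using 1
      ext a
      have : (h.restrictScalars ℚ : k ≃ₐ[ℚ] k)⁻¹ (algebraMap K k a) = algebraMap K k a :=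
        h.symm.commutes a
      simp [this]
    · intro σ hσ
      simp only [extendedType, Finset.mem_filter, Finset.mem_univ, true_and] at hσ ⊢
      convert hσ using 1
      ext a
      simp
    · intro σ _
      simp
    · intro σ _
      simp
    · intro σ _
      rw [← torusGal_mul, mul_inv_rev, inv_inv]
  have mem : ∀ x : Torus k R, ((typeNorm R ι Φ x : Torus k R) : R ⊗[ℚ] k) ∈
      (tensorIncl K k R).range := fun x =>
    mem_range_of_fixed R _ fun h => congrArg Units.val (fixed x h)
  obtain ⟨y, hy⟩ := mem x
  obtain ⟨z, hz⟩ := mem x⁻¹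
  have inj : Function.Injective (tensorIncl K k R) :=
    Module.Flat.lTensor_preserves_injective_linearMap (M := R)
      (algebraMap K k).toRatAlgHom.toLinearMap (algebraMap K k).injective
  change tensorIncl K k R y = _ at hy
  change tensorIncl K k R z = _ at hz
  have hyz : y * z = 1 := inj (by rw [map_mul, hy, hz, map_inv, map_one, Units.mul_inv])
  exact ⟨⟨y, z, hyz, by rw [mul_comm, hyz]⟩, Units.ext hy⟩

/-- The reflex norm map `ψ : T^k → T^K`, on `R`-points: the factorization of `N_{Φ_k⁻¹}` through
the subtorus `T^K ⊆ T^k`. -/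
def reflexNorm [IsGalois ℚ k] (ι : k →+* ℂ) (Φ : Finset (K →+* ℂ)) : Torus k R →* Torus K R :=
  (MonoidHom.ofInjective (torusIncl_injective (K := K) (k := k) R)).symm.toMonoidHom.comp
    ((typeNorm R ι Φ).codRestrict (torusIncl K k R).range (typeNorm_mem_range R ι Φ))

theorem torusIncl_reflexNorm [IsGalois ℚ k] (ι : k →+* ℂ) (Φ : Finset (K →+* ℂ))
    (x : Torus k R) : torusIncl K k R (reflexNorm R ι Φ x) = typeNorm R ι Φ x :=
  congrArg Subtype.val ((MonoidHom.ofInjective (torusIncl_injective (K := K) (k := k) R)).apply_symm_apply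
    ⟨typeNorm R ι Φ x, typeNorm_mem_range R ι Φ x⟩)

/-- The group of complex points of the image torus `T₀ = ψ(T^k) ⊆ T^K`. -/
def imageTorus [IsGalois ℚ k] (ι : k →+* ℂ) (Φ : Finset (K →+* ℂ)) : Subgroup (Torus K ℂ) :=
  (reflexNorm ℂ ι Φ).range

end CM

/-! ## Complex multiplication -/

namespace AbelianVariety

variable {W : Type u} [NormedAddCommGroup W] [NormedSpace ℂ W] [FiniteDimensional ℂ W]
  (A : AbelianVariety W) {K : Type v} [Field K] [NumberField K]

/-- `(A, i)` is of CM type `(K, Φ)`: `Φ` is a CM type of the CM field `K`,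
`2 dim A = [K : ℚ]`, and the character of the representation of `K` on the
Lie algebra of `A` is `∑_{φ ∈ Φ} φ`. -/
structure IsOfCMType (i : K →+* A.End0) (Φ : Finset (K →+* ℂ)) : Prop where
  isCMField : NumberField.IsCMField K
  isCMType : IsCMType Φ
  injective : Function.Injective i
  two_mul_dim : 2 * Module.finrank ℂ W = Module.finrank ℚ K
  character : ∀ a : K, LinearMap.trace ℂ W (A.actLie (i a)) = ∑ φ ∈ Φ, φ a

/-- The `ℂ`-algebra homomorphism `ℂ ⊗ K → End(V_ℂ)`, `z ⊗ a ↦ z • H₁(i(a))`. -/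
def torusAct (i : K →+* A.End0) : ℂ ⊗[ℚ] K →ₐ[ℂ] Module.End ℂ A.H1C :=
  Algebra.TensorProduct.lift (Algebra.ofId ℂ _)
    ((Module.End.baseChangeHom ℚ ℂ A.H1).comp (A.actH1.comp i.toRatAlgHom))
    (fun z _ => Algebra.commutes z _)

theorem torusAct_tmul (i : K →+* A.End0) (z c : ℂ) (a : K) (v : A.H1) :
    A.torusAct i (z ⊗ₜ a) (c ⊗ₜ v) = (z * c) ⊗ₜ (A.actH1 (i a) v) := by
  have h : A.torusAct i (z ⊗ₜ a) = algebraMap ℂ (Module.End ℂ A.H1C) z *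
      Module.End.baseChangeHom ℚ ℂ A.H1 (A.actH1 (i a)) :=
    Algebra.TensorProduct.lift_tmul _ _ _ _ _
  rw [h]
  rfl

/-- The inclusion `T^K ⊆ GL(V)` given by the action of `K` on `V`, on complex points. -/
def torusToGL (i : K →+* A.End0) : Torus K ℂ →* A.GLC :=
  Units.map (A.torusAct i : ℂ ⊗[ℚ] K →* Module.End ℂ A.H1C)

end AbelianVariety

end CMAV

end

/-!
The Mumford–Tate group of an abelian variety of CM type is the image of the reflex norm.

Over `ℂ` the torus `T^K` splits: `T^K(ℂ) = ∏_{φ ∈ Σ_K} ℂˣ`, and likewise for `T^k`, with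
`Σ_k = Gal(k/ℚ)`.  Since `[K : ℚ] = 2 dim A`, the space `V` is a line over `K`, so that `V_ℂ` is free
of rank one over `ℂ ⊗ K`, and `T^K` is the centralizer of `K` in `GL(V)`.  The idempotent of `ℂ ⊗ K`
supported outside of `Φ` has trace zero on `Lie(A)`, hence acts there as zero.  As the complement of
`Φ` is the conjugate of `Φ`, it follows that the idempotent supported on `Φ` is the projection of
`V_ℂ` to `V^{-1,0}` (`IsOfCMType.hodgeEnd_eq`).  So `μ(z)` is the point of `T^K` with coordinates `z`
on `Φ` and `1` elsewhere.  In coordinates (`torusEquiv_reflexNorm`) this is `ψ(z at ι)`, where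
`z at ι` is the point of `T^k` with coordinate `z` at the given embedding `ι` of `k` and `1` elsewhere
(`IsOfCMType.hodgeCochar_eq`).

*`T₀ ⊆ MT(A)`* (`IsOfCMType.map_imageTorus_le`).  The points `z at ι ∘ ρ`, for `ρ ∈ Gal(k/ℚ)`, generate
`T^k(ℂ)`.  A rational equation of `MT(A)`, restricted to `z ↦ ψ(z at ι ∘ ρ)`, is a polynomial in `z`
obtained by applying `ρ` to the coefficients of the one for `ρ = 1`.  The latter vanishes on `ℂˣ`,
so all of them are zero.

*`MT(A) ⊆ T₀`*.  It remains to see that `T₀` is an algebraic `ℚ`-subgroup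
(`isAlgebraicSubgroup_map_imageTorus`).  Since `ℂˣ` is divisible, `T₀` is cut out in `T^K` by the
characters trivial on it (`exists_eq_prod_zpow`).  They give equations over `k`, whose Galois
conjugates hold on `T₀` too, and taking traces turns them into rational equations
(`eval₂_eq_zero_of_descent`).
-/

open scoped TensorProduct

noncomputable section

namespace CMAV

/-! ### Splitting the torus of a number field -/

section Evaluation

variable {K L : Type*} [Field K] [NumberField K] [Field L] [Algebra ℚ L]

/-- The evaluation `L ⊗ K → L`, `z ⊗ a ↦ z φ(a)`, at a ring homomorphism `φ : K → L`.  For `L = ℂ`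
these are the characters `φ ∈ Σ_K` of the torus `T^K`. -/
def tensorEval (φ : K →+* L) : L ⊗[ℚ] K →ₐ[L] L :=
  Algebra.TensorProduct.lift (AlgHom.id L L) φ.toRatAlgHom fun _ _ => Commute.all _ _

@[simp]
theorem tensorEval_tmul (φ : K →+* L) (z : L) (a : K) : tensorEval φ (z ⊗ₜ a) = z * φ a :=
  Algebra.TensorProduct.lift_tmul _ _ _ _ _

/-- All the evaluations together, as a homomorphism `L ⊗ K → ∏_{φ : K → L} L`. -/
def tensorEvalPi (K L : Type*) [Field K] [NumberField K] [Field L] [Algebra ℚ L] :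
    L ⊗[ℚ] K →ₐ[L] ((K →+* L) → L) :=
  AlgHom.pi tensorEval

@[simp]
theorem tensorEvalPi_apply (x : L ⊗[ℚ] K) (φ : K →+* L) :
    tensorEvalPi K L x φ = tensorEval φ x :=
  rfl

/-- If `L` splits `K`, then `L ⊗ K` is a product of copies of `L`, by Dedekind's independence of
characters. -/
theorem tensorEvalPi_bijective [Finite (K →+* L)]
    (h : Nat.card (K →+* L) = Module.finrank ℚ K) : Function.Bijective (tensorEvalPi K L) := by
  have := Fintype.ofFinite (K →+* L)
  have hs : Function.Surjective (tensorEvalPi K L).toLinearMap := by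
    rw [← LinearMap.range_eq_top]
    by_contra hne
    -- A linear form vanishing on the range is a linear relation between the homomorphisms `K → L`.
    obtain ⟨f, hf0, hf⟩ := Submodule.exists_le_ker_of_lt_top _ (lt_top_iff_ne_top.2 hne)
    classical
    have hlin := (linearIndependent_monoidHom K L).comp
      (fun φ : K →+* L => (φ : K →* L)) (fun φ ψ h => RingHom.ext fun a => DFunLike.congr_fun h a)
    rw [Fintype.linearIndependent_iff] at hlin
    have hc := hlin (fun φ => f fun ψ => if φ = ψ then 1 else 0) (by
      funext a
      have h1 : f (tensorEvalPi K L (1 ⊗ₜ a)) = 0 := hf ⟨1 ⊗ₜ a, rfl⟩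
      rw [LinearMap.pi_apply_eq_sum_univ f] at h1
      simpa [Finset.sum_apply, mul_comm] using h1)
    refine hf0 (LinearMap.ext fun x => ?_)
    rw [LinearMap.pi_apply_eq_sum_univ f]
    simp only [hc, smul_zero, Finset.sum_const_zero, LinearMap.zero_apply]
  have hd : Module.finrank L (L ⊗[ℚ] K) = Module.finrank L ((K →+* L) → L) := by
    rw [Module.finrank_baseChange, Module.finrank_fintype_fun_eq_card, ← h,
      Nat.card_eq_fintype_card]
  exact ⟨(LinearMap.injective_iff_surjective_of_finrank_eq_finrank hd).2 hs, hs⟩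

theorem tensorEvalPi_complex_bijective : Function.Bijective (tensorEvalPi K ℂ) :=
  tensorEvalPi_bijective (by rw [Nat.card_eq_fintype_card, NumberField.Embeddings.card K ℂ])

theorem tensorEval_ext {x y : ℂ ⊗[ℚ] K} (h : ∀ φ : K →+* ℂ, tensorEval φ x = tensorEval φ y) :
    x = y :=
  tensorEvalPi_complex_bijective.1 (funext h)

variable {k : Type*} [Field k] [NumberField k]

/-- A Galois extension of `ℚ` containing `K` splits `K`. -/
theorem tensorEvalPi_galois_bijective [Algebra K k] [IsGalois ℚ k] :
    Function.Bijective (tensorEvalPi K k) := by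
  have hc : Nat.card (K →ₐ[ℚ] k) = Module.finrank ℚ K := by
    rw [Nat.card_eq_fintype_card]
    refine AlgHom.card_of_splits ℚ K k fun x => ?_
    have : (minpoly ℚ (algebraMap K k x)) = minpoly ℚ x :=
      minpoly.algHom_eq (algebraMap K k).toRatAlgHom (algebraMap K k).injective x
    rw [← this]
    exact Normal.splits inferInstance _
  have : Finite (K →+* k) := .of_equiv _ (RingHom.equivRatAlgHom K k).symm
  exact tensorEvalPi_bijective (by rw [← hc]; exact Nat.card_congr (RingHom.equivRatAlgHom K k))

/-- The torus `T^K` splits over `ℂ`: the identification of `T^K(ℂ)` with `∏_{φ ∈ Σ_K} ℂˣ`. -/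
def torusEquiv (K : Type*) [Field K] [NumberField K] : Torus K ℂ ≃* ((K →+* ℂ) → ℂˣ) :=
  (Units.mapEquiv (MulEquiv.ofBijective (tensorEvalPi K ℂ) tensorEvalPi_complex_bijective)).trans
    MulEquiv.piUnits

theorem torusEquiv_apply (x : Torus K ℂ) (φ : K →+* ℂ) :
    (torusEquiv K x φ : ℂ) = tensorEval φ (x : ℂ ⊗[ℚ] K) := rfl

/-- The identification of `Gal(k/ℚ)` with `Σ_k`. -/
theorem comp_galois_bijective [IsGalois ℚ k] (ι : k →+* ℂ) :
    Function.Bijective fun σ : k ≃ₐ[ℚ] k => ι.comp (σ : k →+* k) := by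
  refine (Fintype.bijective_iff_injective_and_card _).2 ⟨fun σ τ h => ?_, ?_⟩
  · ext a
    exact ι.injective (DFunLike.congr_fun h a)
  · rw [← Nat.card_eq_fintype_card, IsGalois.card_aut_eq_finrank, NumberField.Embeddings.card k ℂ]

theorem exists_comp_galois_eq [Algebra K k] [IsGalois ℚ k] (ι : k →+* ℂ) (φ : K →+* ℂ) :
    ∃ σ : k ≃ₐ[ℚ] k, (ι.comp (σ : k →+* k)).comp (algebraMap K k) = φ := by
  obtain ⟨σ, hσ⟩ := (comp_galois_bijective ι).2 (NumberField.ComplexEmbedding.lift k φ)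
  exact ⟨σ, by rw [show ι.comp (σ : k →+* k) = _ from hσ,
    NumberField.ComplexEmbedding.lift_comp_algebraMap]⟩

end Evaluation

/-! ### `H₁(A, ℚ)` as a one-dimensional space over `K` -/

namespace AbelianVariety

variable {W : Type*} [NormedAddCommGroup W] [NormedSpace ℂ W] [FiniteDimensional ℂ W]
  (A : AbelianVariety W) {K : Type*} [Field K] [NumberField K] (i : K →+* A.End0)

theorem finrank_H1 : Module.finrank ℚ A.H1 = 2 * Module.finrank ℂ W := by
  rw [Module.finrank_baseChange, ZLattice.rank ℝ A.lattice, ← finrank_real_of_complex]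

instance finite_H1 : Module.Finite ℚ A.H1 := by
  have : Module.Finite ℤ A.lattice := ZLattice.module_finite ℝ A.lattice
  infer_instance

/-- If `[K : ℚ] = 2 dim A`, then `H₁(A, ℚ)` is a one-dimensional vector space over `K`. -/
theorem exists_cyclic_vector (h : 2 * Module.finrank ℂ W = Module.finrank ℚ K) :
    ∃ v : A.H1, Function.Bijective fun a : K => A.actH1 (i a) v := by
  let f : K →+* Module.End ℚ A.H1 := (A.actH1 : A.End0 →+* Module.End ℚ A.H1).comp i
  have hd : Module.finrank ℚ A.H1 = Module.finrank ℚ K := by rw [A.finrank_H1, h]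
  have hpos : 0 < Module.finrank ℚ A.H1 := hd ▸ Module.finrank_pos
  have : Nontrivial A.H1 := Module.nontrivial_of_finrank_pos hpos
  obtain ⟨v, hv⟩ := exists_ne (0 : A.H1)
  refine ⟨v, ?_⟩
  let l : K →ₗ[ℚ] A.H1 := (LinearMap.applyₗ v).comp
    (A.actH1.comp i.toRatAlgHom).toLinearMap
  have hl : Function.Injective l := by
    rw [injective_iff_map_eq_zero]
    intro a ha
    by_contra ha0
    refine hv ?_
    have h1 : f a⁻¹ (f a v) = v := by
      rw [← Module.End.mul_apply, ← map_mul, inv_mul_cancel₀ ha0, map_one, Module.End.one_apply]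
    rw [← h1, show f a v = 0 from ha, map_zero]
  exact ⟨hl, (LinearMap.injective_iff_surjective_of_finrank_eq_finrank hd.symm).1 hl⟩

/-- A vector `v ∈ V` on which `K` acts simply transitively gives an identification `K ≃ V`. -/
def cyclicEquiv {v : A.H1} (hv : Function.Bijective fun a : K => A.actH1 (i a) v) : K ≃ₗ[ℚ] A.H1 :=
  LinearEquiv.ofBijective
    ((LinearMap.applyₗ v).comp (A.actH1.comp i.toRatAlgHom).toLinearMap) hv

theorem cyclicEquiv_apply {v : A.H1} (hv : Function.Bijective fun a : K => A.actH1 (i a) v)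
    (a : K) : A.cyclicEquiv i hv a = A.actH1 (i a) v := rfl

theorem torusAct_cyclic {v : A.H1} (hv : Function.Bijective fun a : K => A.actH1 (i a) v)
    (y : ℂ ⊗[ℚ] K) :
    A.torusAct i y (1 ⊗ₜ v) = (A.cyclicEquiv i hv).baseChange ℚ ℂ K A.H1 y := by
  induction y with
  | zero => simp
  | add x y hx hy => rw [map_add, map_add, LinearMap.add_apply, hx, hy]
  | tmul z a => rw [torusAct_tmul, LinearEquiv.baseChange_tmul, cyclicEquiv_apply, mul_one]

theorem torusAct_cyclic_bijective {v : A.H1}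
    (hv : Function.Bijective fun a : K => A.actH1 (i a) v) :
    Function.Bijective fun y : ℂ ⊗[ℚ] K => A.torusAct i y (1 ⊗ₜ v) := by
  simp only [A.torusAct_cyclic i hv]
  exact ((A.cyclicEquiv i hv).baseChange ℚ ℂ K A.H1).bijective

/-- An endomorphism of `V_ℂ` commuting with `K` is the action of an element of `ℂ ⊗ K`, because
`V_ℂ` is free of rank one over `ℂ ⊗ K`. -/
theorem eq_torusAct_of_commute {v : A.H1}
    (hv : Function.Bijective fun a : K => A.actH1 (i a) v) (g : Module.End ℂ A.H1C)
    (hg : ∀ a : K, Commute g (A.torusAct i (1 ⊗ₜ a))) {y : ℂ ⊗[ℚ] K}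
    (hy : A.torusAct i y (1 ⊗ₜ v) = g (1 ⊗ₜ v)) : g = A.torusAct i y := by
  have hg' : ∀ x : ℂ ⊗[ℚ] K, Commute g (A.torusAct i x) := by
    intro x
    induction x with
    | zero => rw [map_zero]; exact Commute.zero_right _
    | add x y hx hy => rw [map_add]; exact hx.add_right hy
    | tmul z a =>
      have : (z ⊗ₜ[ℚ] a : ℂ ⊗[ℚ] K) = z • (1 ⊗ₜ a) := by simp [TensorProduct.smul_tmul']
      rw [this, map_smul]
      exact (hg a).smul_right z
  refine LinearMap.ext fun w => ?_
  obtain ⟨x, rfl⟩ := (A.torusAct_cyclic_bijective i hv).2 w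
  change g (A.torusAct i x _) = A.torusAct i y (A.torusAct i x _)
  rw [← Module.End.mul_apply, (hg' x).eq, Module.End.mul_apply, ← hy, ← Module.End.mul_apply,
    ← Module.End.mul_apply, ← map_mul, ← map_mul, mul_comm]

/-- The torus `T^K` is the centralizer of `K` in `GL(V)`. -/
theorem mem_range_torusToGL {v : A.H1}
    (hv : Function.Bijective fun a : K => A.actH1 (i a) v) (g : A.GLC)
    (hg : ∀ a : K, Commute (g : Module.End ℂ A.H1C) (A.torusAct i (1 ⊗ₜ a))) :
    ∃ y : Torus K ℂ, A.torusToGL i y = g := by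
  obtain ⟨y, hy⟩ := (A.torusAct_cyclic_bijective i hv).2 ((g : Module.End ℂ A.H1C) (1 ⊗ₜ v))
  obtain ⟨z, hz⟩ := (A.torusAct_cyclic_bijective i hv).2
    (((g⁻¹ : A.GLC) : Module.End ℂ A.H1C) (1 ⊗ₜ v))
  have ey := A.eq_torusAct_of_commute i hv _ hg hy
  have ez := A.eq_torusAct_of_commute i hv _ (fun a => (hg a).units_inv_left) hz
  have hyz : y * z = 1 := (A.torusAct_cyclic_bijective i hv).1 (by
    change A.torusAct i (y * z) _ = A.torusAct i 1 _
    rw [map_mul, ← ey, ← ez, Units.mul_inv, map_one])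
  exact ⟨⟨y, z, hyz, by rw [mul_comm, hyz]⟩, Units.ext ey.symm⟩

/-- Matrix coefficients of the torus come from `ℚ`-linear functionals on `K`. -/
theorem matrixCoeff_torusToGL (y : Torus K ℂ) (ℓ : Module.Dual ℚ A.H1) (v : A.H1) :
    A.matrixCoeff (A.torusToGL i y) (ℓ, v) = TensorProduct.rid ℚ ℂ
      ((ℓ ∘ₗ (LinearMap.applyₗ v).comp (A.actH1.comp i.toRatAlgHom).toLinearMap).lTensor ℂ
        (y : ℂ ⊗[ℚ] K)) := by
  change TensorProduct.rid ℚ ℂ (LinearMap.baseChange ℂ ℓ (A.torusAct i y.1 (1 ⊗ₜ v))) = _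
  congr 1
  induction y.1 with
  | zero => simp
  | add x y hx hy => rw [map_add, map_add, LinearMap.add_apply, map_add, hx, hy]
  | tmul z a => simp [torusAct_tmul]

end AbelianVariety

/-! ### The Hodge decomposition and the CM type -/

/-- Conjugating the left factor of `ℂ ⊗ K` replaces an evaluation by the conjugate of the evaluation
at the conjugate embedding. -/
theorem tensorEval_conj {K : Type*} [Field K] [NumberField K] (φ : K →+* ℂ) (y : ℂ ⊗[ℚ] K) :
    tensorEval φ ((Complex.conjAe.toLinearMap.restrictScalars ℚ).rTensor K y) =
      starRingEnd ℂ (tensorEval (NumberField.ComplexEmbedding.conjugate φ) y) := by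
  induction y with
  | zero => simp
  | add x y hx hy => simp only [map_add, hx, hy]
  | tmul z a =>
    simp [NumberField.ComplexEmbedding.conjugate_coe_eq]

namespace AbelianVariety

variable {W : Type*} [NormedAddCommGroup W] [NormedSpace ℂ W] [FiniteDimensional ℂ W]
  (A : AbelianVariety W) {K : Type*} [Field K] [NumberField K] (i : K →+* A.End0)

theorem period_actH1 (e : A.End0) (c : ℂ) (v : A.H1) :
    A.period (c ⊗ₜ A.actH1 e v) = A.actLie e (A.period (c ⊗ₜ v)) := by
  induction e using TensorProduct.induction_on with
  | zero => simp
  | add e f he hf =>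
    simp only [map_add, LinearMap.add_apply, TensorProduct.tmul_add, he, hf]
  | tmul q f =>
    induction v using TensorProduct.induction_on with
    | zero => simp
    | add x y hx hy => simp only [map_add, TensorProduct.tmul_add, hx, hy]
    | tmul q' x =>
      rw [actH1_tmul, period_tmul, period_tmul, actLie_tmul, map_smul, smul_smul]
      push_cast
      rw [mul_assoc]

/-- The `ℂ`-linear extension to `ℂ ⊗ K` of the representation of `K` on `Lie(A)`. -/
theorem exists_lieAct : ∃ L : ℂ ⊗[ℚ] K →ₐ[ℂ] Module.End ℂ W,
    ∀ z a, L (z ⊗ₜ a) = z • A.actLie (i a) := by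
  -- `W` carries no `ℚ`-module instance, but `AlgHom`s out of `ℂ ⊗[ℚ] K` need one.
  let : Module ℚ W := Module.compHom W (algebraMap ℚ ℂ)
  have : IsScalarTower ℚ ℂ W := ⟨fun q z w => by
    change (q • z) • w = (algebraMap ℚ ℂ q) • (z • w)
    rw [Algebra.smul_def, mul_smul]⟩
  exact ⟨Algebra.TensorProduct.lift (Algebra.ofId ℂ _) (A.actLie.comp i).toRatAlgHom
    (fun z _ => Algebra.commutes z _), fun z a =>
      (Algebra.TensorProduct.lift_tmul _ _ _ _ _).trans (Algebra.smul_def _ _).symm⟩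

theorem period_torusAct (L : ℂ ⊗[ℚ] K →ₐ[ℂ] Module.End ℂ W)
    (hL : ∀ z a, L (z ⊗ₜ a) = z • A.actLie (i a)) (y : ℂ ⊗[ℚ] K) (x : A.H1C) :
    A.period (A.torusAct i y x) = L y (A.period x) := by
  induction y with
  | zero => simp
  | add y z hy hz => simp only [map_add, LinearMap.add_apply, hy, hz]
  | tmul z a =>
    induction x using TensorProduct.induction_on with
    | zero => simp
    | add x y hx hy => simp only [map_add, hx, hy]
    | tmul c v =>
      have e : ((z * c) ⊗ₜ[ℚ] A.actH1 (i a) v : A.H1C) = z • (c ⊗ₜ A.actH1 (i a) v) := by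
        simp [TensorProduct.smul_tmul']
      rw [torusAct_tmul, e, map_smul, period_actH1, hL, LinearMap.smul_apply]

theorem conj_torusAct (y : ℂ ⊗[ℚ] K) (x : A.H1C) :
    A.conj (A.torusAct i y x) = A.torusAct i
      ((Complex.conjAe.toLinearMap.restrictScalars ℚ).rTensor K y) (A.conj x) := by
  induction y with
  | zero => simp
  | add y z hy hz => simp only [map_add, LinearMap.add_apply, hy, hz]
  | tmul z a =>
    induction x using TensorProduct.induction_on with
    | zero => simp
    | add x y hx hy => simp only [map_add, hx, hy]
    | tmul c v =>
      rw [torusAct_tmul, conj_tmul, conj_tmul, LinearMap.rTensor_tmul, torusAct_tmul, map_mul]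
      rfl

variable {i} in
/-- An idempotent of `ℂ ⊗ K` which is supported outside of `Φ` acts as zero on `Lie(A)`, because
its trace there is zero. -/
theorem IsOfCMType.period_torusAct_eq_zero {Φ : Finset (K →+* ℂ)} (hA : A.IsOfCMType i Φ)
    {e : ℂ ⊗[ℚ] K} (he : IsIdempotentElem e) (h : ∀ φ ∈ Φ, tensorEval φ e = 0) (x : A.H1C) :
    A.period (A.torusAct i e x) = 0 := by
  obtain ⟨L, hL⟩ := A.exists_lieAct i
  have htr : ∀ y : ℂ ⊗[ℚ] K, LinearMap.trace ℂ W (L y) = ∑ φ ∈ Φ, tensorEval φ y := by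
    intro y
    induction y with
    | zero => simp
    | add y z hy hz => simp only [map_add, hy, hz, Finset.sum_add_distrib]
    | tmul z a => simp [hL, hA.character, Finset.mul_sum]
  have h0 : L e = 0 := (LinearMap.IsIdempotentElem.trace_eq_zero_iff (he.map L)).1 (by
    rw [htr, Finset.sum_eq_zero h])
  rw [A.period_torusAct i L hL, h0, LinearMap.zero_apply]

variable {i} in
open Classical in
/-- The Hodge cocharacter factors through `T^K`: the idempotent `e` of `ℂ ⊗ K` supported on `Φ`
acts on `V_ℂ` as the projection to `V^{-1,0}`.  Indeed `1 - e` maps `V_ℂ` into `V^{0,-1}`, and since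
`Φ` is a CM type, `e` is the complex conjugate of `1 - e`, hence maps `V_ℂ` into `V^{-1,0}`. -/
theorem IsOfCMType.hodgeEnd_eq {Φ : Finset (K →+* ℂ)} (hA : A.IsOfCMType i Φ)
    {e : ℂ ⊗[ℚ] K} (he : ∀ φ, tensorEval φ e = if φ ∈ Φ then 1 else 0) (z : ℂ) :
    A.hodgeEnd z = A.torusAct i (1 + (z - 1) • e) := by
  have hid : IsIdempotentElem (1 - e) := tensorEval_ext fun φ => by
    by_cases h : φ ∈ Φ <;> simp [he, h]
  have hconj : (Complex.conjAe.toLinearMap.restrictScalars ℚ).rTensor K e = 1 - e :=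
    tensorEval_ext fun φ => by
      rw [tensorEval_conj, he, map_sub, map_one, he]
      by_cases h : φ ∈ Φ
      · have h' : NumberField.ComplexEmbedding.conjugate φ ∉ Φ :=
          fun h' => (hA.isCMType φ).2 h' h
        simp [h, h']
      · simp [h, (hA.isCMType φ).1 h]
  have h0 : ∀ x, A.torusAct i (1 - e) x ∈ A.hodgeZero := fun x =>
    hA.period_torusAct_eq_zero A hid (fun φ hφ => by simp [he, hφ]) x
  have h1 : ∀ x, A.torusAct i e x ∈ A.hodgeMinusOne := fun x => by
    rw [mem_hodgeMinusOne, conj_torusAct, hconj]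
    exact h0 _
  have hadd : ∀ x, A.torusAct i e x + A.torusAct i (1 - e) x = x := fun x => by
    rw [← LinearMap.add_apply, ← map_add, add_sub_cancel, map_one, Module.End.one_apply]
  have hdisj := Submodule.disjoint_def.1 A.isCompl_hodge.disjoint
  refine A.hodge_ext (fun x hx => ?_) fun x hx => ?_
  · have hz : A.torusAct i (1 - e) x = 0 := by
      refine hdisj _ ?_ (h0 x)
      rw [eq_sub_of_add_eq' (hadd x)]
      exact sub_mem hx (h1 x)
    have hx' := hadd x
    rw [hz, add_zero] at hx'
    rw [A.hodgeEnd_of_mem_minusOne z hx, map_add, map_smul, map_one, LinearMap.add_apply,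
      LinearMap.smul_apply, hx', Module.End.one_apply, sub_smul, one_smul, add_sub_cancel]
  · have hz : A.torusAct i e x = 0 := by
      refine hdisj _ (h1 x) ?_
      rw [eq_sub_of_add_eq (hadd x)]
      exact sub_mem hx (h0 x)
    rw [A.hodgeEnd_of_mem_zero z hx, map_add, map_smul, map_one, LinearMap.add_apply,
      LinearMap.smul_apply, hz, Module.End.one_apply, smul_zero, add_zero]

end AbelianVariety

/-! ### The reflex norm in coordinates and the Galois conjugates of the Hodge cocharacter -/

section ReflexNorm

open scoped Classical

variable {K k : Type*} [Field K] [NumberField K] [Field k] [NumberField k] [Algebra K k]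

theorem tensorEval_torusGal (ψ : k →+* ℂ) (ρ : k ≃ₐ[ℚ] k) (x : Torus k ℂ) :
    tensorEval ψ (torusGal ℂ ρ x : ℂ ⊗[ℚ] k) =
      tensorEval (ψ.comp (ρ : k →+* k)) (x : ℂ ⊗[ℚ] k) := by
  change tensorEval ψ (Algebra.TensorProduct.map (AlgHom.id ℚ ℂ) (ρ : k →ₐ[ℚ] k) x.1) = _
  induction x.1 with
  | zero => simp
  | add x y hx hy => simp only [map_add, hx, hy]
  | tmul z a => simp

theorem tensorEval_torusIncl (ψ : k →+* ℂ) (y : Torus K ℂ) :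
    tensorEval ψ (torusIncl K k ℂ y : ℂ ⊗[ℚ] k) =
      tensorEval (ψ.comp (algebraMap K k)) (y : ℂ ⊗[ℚ] K) := by
  change tensorEval ψ (tensorIncl K k ℂ y.1) = _
  induction y.1 with
  | zero => simp
  | add x y hx hy => simp only [map_add, hx, hy]
  | tmul z a => simp [tensorIncl]

variable [IsGalois ℚ k] (ι : k →+* ℂ) (Φ : Finset (K →+* ℂ))

omit [NumberField K] in
theorem mem_extendedType {σ : k ≃ₐ[ℚ] k} : σ ∈ extendedType ι Φ ↔
    (ι.comp (σ : k →+* k)).comp (algebraMap K k) ∈ Φ := by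
  simp [extendedType]

/-- The reflex norm in coordinates: the coordinate of `ψ(x)` at `σ|_K` is the product of the
coordinates of `x` at those `ρ` for which `ρ⁻¹ σ` lies in `Φ_k`. -/
theorem torusEquiv_reflexNorm (x : Torus k ℂ) (σ : k ≃ₐ[ℚ] k) :
    torusEquiv K (reflexNorm ℂ ι Φ x) ((ι.comp (σ : k →+* k)).comp (algebraMap K k)) =
      ∏ ρ : k ≃ₐ[ℚ] k, torusEquiv k x (ι.comp (ρ : k →+* k)) ^
        (if ρ⁻¹ * σ ∈ extendedType ι Φ then 1 else 0 : ℤ) := by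
  have h1 : torusEquiv K (reflexNorm ℂ ι Φ x)
      ((ι.comp (σ : k →+* k)).comp (algebraMap K k)) =
      torusEquiv k (typeNorm ℂ ι Φ x) (ι.comp (σ : k →+* k)) := by
    ext
    rw [torusEquiv_apply, torusEquiv_apply, ← torusIncl_reflexNorm, tensorEval_torusIncl]
  have h2 : ∀ τ : k ≃ₐ[ℚ] k, torusEquiv k (torusGal ℂ τ⁻¹ x) (ι.comp (σ : k →+* k)) =
      torusEquiv k x (ι.comp ((σ * τ⁻¹ : k ≃ₐ[ℚ] k) : k →+* k)) := by
    intro τ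
    ext
    rw [torusEquiv_apply, torusEquiv_apply, tensorEval_torusGal]
    rfl
  rw [h1, typeNorm_apply, map_prod, Finset.prod_apply]
  simp only [h2, apply_ite (HPow.hPow _), zpow_one, zpow_zero]
  rw [← Finset.prod_filter]
  refine Finset.prod_nbij' (fun τ => σ * τ⁻¹) (fun ρ => ρ⁻¹ * σ) ?_ ?_ ?_ ?_ ?_ <;>
    simp

/-- The point of `T^k(ℂ)` with coordinate `z` at `ι ∘ ρ` and `1` at the other embeddings. -/
def torusSingle (ρ : k ≃ₐ[ℚ] k) (z : ℂˣ) : Torus k ℂ :=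
  (torusEquiv k).symm (Pi.mulSingle (ι.comp (ρ : k →+* k)) z)

theorem torusEquiv_reflexNorm_single (ρ σ : k ≃ₐ[ℚ] k) (z : ℂˣ) :
    torusEquiv K (reflexNorm ℂ ι Φ (torusSingle ι ρ z))
      ((ι.comp (σ : k →+* k)).comp (algebraMap K k)) =
      z ^ (if ρ⁻¹ * σ ∈ extendedType ι Φ then 1 else 0 : ℤ) := by
  rw [torusEquiv_reflexNorm, Finset.prod_eq_single ρ]
  · simp [torusSingle]
  · intro τ _ hτ
    have : ι.comp (τ : k →+* k) ≠ ι.comp (ρ : k →+* k) :=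
      fun h => hτ ((comp_galois_bijective ι).1 h)
    simp [torusSingle, Pi.mulSingle_eq_of_ne this]
  · simp

/-- The idempotent of `k ⊗ K` cutting out the embeddings of `K` into `k` that lie in `Φ`. -/
theorem exists_typeIdempotent : ∃ e : k ⊗[ℚ] K, ∀ σ : k ≃ₐ[ℚ] k,
    tensorEval ((σ : k →+* k).comp (algebraMap K k)) e =
      if σ ∈ extendedType ι Φ then 1 else 0 := by
  obtain ⟨e, he⟩ := (tensorEvalPi_galois_bijective (K := K) (k := k)).2
    fun τ => if ι.comp τ ∈ Φ then 1 else 0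
  refine ⟨e, fun σ => ?_⟩
  rw [← tensorEvalPi_apply, he]
  simp only [mem_extendedType, RingHom.comp_assoc]

/-- Extension of scalars `k ⊗ K → ℂ ⊗ K` along an embedding of `k`. -/
def scalarMap (K : Type*) [Field K] [NumberField K] (f : k →+* ℂ) : k ⊗[ℚ] K →ₐ[ℚ] ℂ ⊗[ℚ] K :=
  Algebra.TensorProduct.map f.toRatAlgHom (AlgHom.id ℚ K)

omit [Algebra K k] [IsGalois ℚ k] in
theorem tensorEval_scalarMap (f : k →+* ℂ) (τ : K →+* k) (e : k ⊗[ℚ] K) :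
    tensorEval (f.comp τ) (scalarMap K f e) = f (tensorEval τ e) := by
  induction e with
  | zero => simp
  | add x y hx hy => simp only [map_add, hx, hy]
  | tmul z a => simp [scalarMap]

theorem rid_lTensor_smul {K : Type*} [Field K] [NumberField K] (l : K →ₗ[ℚ] ℚ) (c : ℂ)
    (x : ℂ ⊗[ℚ] K) : TensorProduct.rid ℚ ℂ (l.lTensor ℂ (c • x)) =
      c * TensorProduct.rid ℚ ℂ (l.lTensor ℂ x) := by
  induction x with
  | zero => simp
  | add x y hx hy => simp only [smul_add, map_add, hx, hy, mul_add]
  | tmul z a => simp [TensorProduct.smul_tmul']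

omit [Algebra K k] [IsGalois ℚ k] in
theorem rid_lTensor_scalarMap (f : k →+* ℂ) (l : K →ₗ[ℚ] ℚ) (e : k ⊗[ℚ] K) :
    TensorProduct.rid ℚ ℂ (l.lTensor ℂ (scalarMap K f e)) =
      f (TensorProduct.rid ℚ k (l.lTensor k e)) := by
  induction e with
  | zero => simp
  | add x y hx hy => simp only [map_add, hx, hy]
  | tmul z a => simp [scalarMap, Rat.smul_def]

variable {ι Φ} in
theorem tensorEval_scalarMap_typeIdempotent {e : k ⊗[ℚ] K} (he : ∀ σ : k ≃ₐ[ℚ] k,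
    tensorEval ((σ : k →+* k).comp (algebraMap K k)) e = if σ ∈ extendedType ι Φ then 1 else 0)
    (ρ σ : k ≃ₐ[ℚ] k) :
    tensorEval ((ι.comp (σ : k →+* k)).comp (algebraMap K k))
      (scalarMap K (ι.comp (ρ : k →+* k)) e) =
        if ρ⁻¹ * σ ∈ extendedType ι Φ then 1 else 0 := by
  have h : (ι.comp (σ : k →+* k)).comp (algebraMap K k) = (ι.comp (ρ : k →+* k)).comp
      (((ρ⁻¹ * σ : k ≃ₐ[ℚ] k) : k →+* k).comp (algebraMap K k)) := by
    ext a
    change ι (σ _) = ι (ρ (ρ⁻¹ (σ _)))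
    rw [← AlgEquiv.mul_apply, mul_inv_cancel, AlgEquiv.one_apply]
  rw [h, tensorEval_scalarMap, he]
  split_ifs <;> simp

variable {ι Φ} in
/-- The cocharacter `z ↦ ψ(z at ι ∘ ρ)` of `T^K` is affine in `z`, and is the translate by `ρ` of the
one at `ρ = 1`. -/
theorem reflexNorm_single_eq {e : k ⊗[ℚ] K} (he : ∀ σ : k ≃ₐ[ℚ] k,
    tensorEval ((σ : k →+* k).comp (algebraMap K k)) e = if σ ∈ extendedType ι Φ then 1 else 0)
    (ρ : k ≃ₐ[ℚ] k) (z : ℂˣ) :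
    (reflexNorm ℂ ι Φ (torusSingle ι ρ z) : ℂ ⊗[ℚ] K) =
      1 + ((z : ℂ) - 1) • scalarMap K (ι.comp (ρ : k →+* k)) e := by
  refine tensorEval_ext fun φ => ?_
  obtain ⟨σ, rfl⟩ := exists_comp_galois_eq ι φ
  rw [← torusEquiv_apply, torusEquiv_reflexNorm_single, map_add, map_smul, map_one,
    tensorEval_scalarMap_typeIdempotent he]
  split_ifs <;> simp

end ReflexNorm

namespace AbelianVariety

variable {W : Type*} [NormedAddCommGroup W] [NormedSpace ℂ W] [FiniteDimensional ℂ W]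
  {A : AbelianVariety W}
  {K k : Type*} [Field K] [NumberField K] [Field k] [NumberField k] [Algebra K k]
  [IsGalois ℚ k] (ι : k →+* ℂ) {i : K →+* A.End0} {Φ : Finset (K →+* ℂ)}

/-- The Hodge cocharacter is the image under `ψ` of the cocharacter of `T^k` at `ι`. -/
theorem IsOfCMType.hodgeCochar_eq (hA : A.IsOfCMType i Φ) (z : ℂˣ) :
    A.hodgeCochar z = A.torusToGL i (reflexNorm ℂ ι Φ (torusSingle ι 1 z)) := by
  classical
  obtain ⟨e, he⟩ := exists_typeIdempotent (K := K) ι Φ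
  ext1
  change A.hodgeEnd z = A.torusAct i _
  rw [reflexNorm_single_eq he]
  refine hA.hodgeEnd_eq A (fun φ => ?_) z
  obtain ⟨σ, rfl⟩ := exists_comp_galois_eq ι φ
  rw [tensorEval_scalarMap_typeIdempotent he]
  simp only [inv_one, one_mul, mem_extendedType]

/-- Along the cocharacter `z ↦ ψ(z at ι ∘ ρ)` of `T₀`, a rational polynomial in the matrix
coefficients is a polynomial in `z`; its coefficients lie in `k`, and passing from `ρ = 1` to
another `ρ` transports them by `ρ`. -/
theorem exists_polynomial_reflexNorm_single (f : MvPolynomial (Module.Dual ℚ A.H1 × A.H1) ℚ) :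
    ∃ Q : Polynomial k, ∀ (ρ : k ≃ₐ[ℚ] k) (z : ℂˣ), MvPolynomial.aeval (A.matrixCoeff
      (A.torusToGL i (reflexNorm ℂ ι Φ (torusSingle ι ρ z)))) f =
        Q.eval₂ (ι.comp (ρ : k →+* k)) z := by
  obtain ⟨e, he⟩ := exists_typeIdempotent (K := K) ι Φ
  let l : Module.Dual ℚ A.H1 × A.H1 → K →ₗ[ℚ] ℚ := fun p =>
    p.1 ∘ₗ (LinearMap.applyₗ p.2).comp (A.actH1.comp i.toRatAlgHom).toLinearMap
  let P : Module.Dual ℚ A.H1 × A.H1 → Polynomial k := fun p =>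
    Polynomial.C (algebraMap ℚ k (l p 1)) +
      (Polynomial.X - 1) * Polynomial.C (TensorProduct.rid ℚ k ((l p).lTensor k e))
  refine ⟨MvPolynomial.aeval P f, fun ρ z => ?_⟩
  let ev : Polynomial k →ₐ[ℚ] ℂ :=
    (Polynomial.eval₂RingHom (ι.comp (ρ : k →+* k)) (z : ℂ)).toRatAlgHom
  change _ = ev (MvPolynomial.aeval P f)
  rw [← AlgHom.comp_apply, MvPolynomial.comp_aeval]
  congr 2
  funext p
  rw [show p = (p.1, p.2) from rfl, matrixCoeff_torusToGL, reflexNorm_single_eq he, map_add,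
    map_add, rid_lTensor_smul, rid_lTensor_scalarMap, Algebra.TensorProduct.one_def]
  simp [ev, P, l]

/-- `T₀ ⊆ MT(A)`: the torus `T₀` is generated by the Galois conjugates of the Hodge cocharacter. -/
theorem IsOfCMType.map_imageTorus_le (hA : A.IsOfCMType i Φ) :
    (imageTorus ι Φ).map (A.torusToGL i) ≤ A.mumfordTate := by
  classical
  obtain ⟨⟨S, hS⟩, hμ⟩ := A.isLeast_mumfordTate.1
  have hsingle : ∀ (ρ : k ≃ₐ[ℚ] k) (z : ℂˣ),
      A.torusToGL i (reflexNorm ℂ ι Φ (torusSingle ι ρ z)) ∈ A.mumfordTate := by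
    intro ρ z
    refine (hS _).2 fun f hf => ?_
    obtain ⟨Q, hQ⟩ := exists_polynomial_reflexNorm_single (i := i) (Φ := Φ) ι f
    -- The polynomial at `ρ = 1` vanishes at every `z ≠ 0`, so it is zero, and so are its conjugates.
    have hQ0 : Q.map ι = 0 := by
      refine Polynomial.eq_zero_of_infinite_isRoot _
        ((Set.finite_singleton (0 : ℂ)).infinite_compl.mono fun w hw => ?_)
      have h := hQ 1 (Units.mk0 w hw)
      rw [← hA.hodgeCochar_eq ι, (hS _).1 (hμ ⟨_, rfl⟩) f hf] at h
      exact (Polynomial.eval_map ι w).trans h.symm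
    rw [hQ, (Polynomial.map_eq_zero ι).1 hQ0, Polynomial.eval₂_zero]
  rintro _ ⟨_, ⟨x, rfl⟩, rfl⟩
  -- Every point of `T^k(ℂ)` is a product of points with a single nontrivial coordinate.
  let H : Subgroup ((k →+* ℂ) → ℂˣ) := A.mumfordTate.comap
    ((A.torusToGL i).comp ((reflexNorm ℂ ι Φ).comp (torusEquiv k).symm.toMonoidHom))
  have hx : torusEquiv k x ∈ H := by
    refine Subgroup.pi_mem_of_mulSingle_mem _ fun ψ => ?_
    obtain ⟨ρ, rfl⟩ := (comp_galois_bijective ι).2 ψ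
    exact hsingle ρ _
  simpa [H] using hx

end AbelianVariety

/-! ### Divisibility, descent and linear equations -/

/-- The group `ℂˣ` is divisible, hence an injective `ℤ`-module. -/
theorem baer_additive_units_complex : Module.Baer ℤ (Additive ℂˣ) := by
  let : DivisibleBy (Additive ℂˣ) ℕ := divisibleByOfSMulRightSurj _ _ fun {n} hn x => by
    obtain ⟨z, hz⟩ := IsAlgClosed.exists_pow_nat_eq (x.toMul : ℂ) (Nat.pos_of_ne_zero hn)
    have hz0 : z ≠ 0 := by
      rintro rfl
      exact x.toMul.ne_zero (by rw [← hz, zero_pow hn])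
    exact ⟨Additive.ofMul (Units.mk0 z hz0), Additive.toMul.injective (Units.ext hz)⟩
  let : DivisibleBy (Additive ℂˣ) ℤ := AddGroup.divisibleByIntOfDivisibleByNat _
  exact Module.Baer.of_divisible _

/-- The image of a homomorphism of split tori over `ℂ` is cut out by the characters trivial on
it.  This is the injectivity of the divisible group `ℂˣ` as a `ℤ`-module. -/
theorem exists_eq_prod_zpow {I J : Type*} [Fintype I] [Fintype J] (M : I → J → ℤ) (y : I → ℂˣ)
    (h : ∀ c : I → ℤ, (∀ j, ∑ i, c i * M i j = 0) → ∏ i, y i ^ c i = 1) :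
    ∃ x : J → ℂˣ, ∀ i, y i = ∏ j, x j ^ M i j := by
  classical
  let N : (I → ℤ) →ₗ[ℤ] (J → ℤ) := Fintype.linearCombination ℤ M
  let f : (I → ℤ) →ₗ[ℤ] Additive ℂˣ := Fintype.linearCombination ℤ fun i => Additive.ofMul (y i)
  have hf : LinearMap.ker N ≤ LinearMap.ker f := by
    intro c hc
    have := h c fun j => by
      simpa [N, Fintype.linearCombination_apply] using congrFun (LinearMap.mem_ker.1 hc) j
    rw [LinearMap.mem_ker]
    simpa [f, Fintype.linearCombination_apply, ← ofMul_zpow, ← ofMul_prod] using this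
  obtain ⟨g, hg⟩ := baer_additive_units_complex.extension_property
    ((LinearMap.ker N).liftQ N le_rfl)
    (LinearMap.ker_eq_bot.1 (Submodule.ker_liftQ_eq_bot' _ _ rfl))
    ((LinearMap.ker N).liftQ f hf)
  have hgN : ∀ c, g (N c) = f c := fun c => LinearMap.congr_fun hg ((LinearMap.ker N).mkQ c)
  refine ⟨fun j => (g (Pi.single j 1)).toMul, fun i => Additive.ofMul.injective ?_⟩
  have h1 := hgN (Pi.single i 1)
  have h2 : M i = ∑ j, M i j • (Pi.single j 1 : J → ℤ) := by
    ext j; simp [Finset.sum_apply, Pi.single_apply]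
  simp only [N, f, Fintype.linearCombination_apply_single, one_smul] at h1
  rw [← h1]
  conv_lhs => rw [h2, map_sum]
  simp only [map_smul, ofMul_prod, ofMul_zpow, ofMul_toMul]

section Descent

variable {k : Type*} [Field k] [NumberField k] [IsGalois ℚ k] (ι : k →+* ℂ) {s : Type*}

/-- The trace to `ℚ` of the polynomial `a P`, coefficient by coefficient. -/
theorem exists_trace_polynomial (P : MvPolynomial s k) (a : k) :
    ∃ f : MvPolynomial s ℚ, ∀ x : s → ℂ, MvPolynomial.aeval x f =
      ∑ ρ : k ≃ₐ[ℚ] k, ι (ρ a) * P.eval₂ (ι.comp (ρ : k →+* k)) x := by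
  induction P using MvPolynomial.induction_on with
  | C c =>
    refine ⟨MvPolynomial.C (Algebra.trace ℚ k (a * c)), fun x => ?_⟩
    have h : ι (algebraMap ℚ k (Algebra.trace ℚ k (a * c))) = ∑ ρ : k ≃ₐ[ℚ] k, ι (ρ (a * c)) := by
      rw [trace_eq_sum_automorphisms, map_sum]
    simpa using h
  | add P Q hP hQ =>
    obtain ⟨f, hf⟩ := hP
    obtain ⟨g, hg⟩ := hQ
    exact ⟨f + g, fun x => by
      simp only [map_add, hf, hg, MvPolynomial.eval₂_add, mul_add, Finset.sum_add_distrib]⟩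
  | mul_X P n hP =>
    obtain ⟨f, hf⟩ := hP
    exact ⟨f * MvPolynomial.X n, fun x => by
      simp only [map_mul, hf, MvPolynomial.aeval_X, MvPolynomial.eval₂_mul, MvPolynomial.eval₂_X,
        Finset.sum_mul, mul_assoc]⟩

/-- Galois descent for equations: suppose that `g` satisfies all the rational equations of `Z`, and
that all Galois conjugates of a polynomial `P` over `k` vanish on `Z`.  Then `P` vanishes at `g`: the
traces of the multiples `a P` vanish at `g`, and Dedekind's independence of characters separates the
conjugates of `P`. -/
theorem eval₂_eq_zero_of_descent (Z : Set (s → ℂ)) (g : s → ℂ)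
    (hg : ∀ f : MvPolynomial s ℚ, (∀ x ∈ Z, MvPolynomial.aeval x f = 0) →
      MvPolynomial.aeval g f = 0)
    (P : MvPolynomial s k)
    (hP : ∀ ρ : k ≃ₐ[ℚ] k, ∀ x ∈ Z, P.eval₂ (ι.comp (ρ : k →+* k)) x = 0) :
    P.eval₂ ι g = 0 := by
  have hsum : ∀ a : k, ∑ ρ : k ≃ₐ[ℚ] k, ι (ρ a) * P.eval₂ (ι.comp (ρ : k →+* k)) g = 0 := by
    intro a
    obtain ⟨f, hf⟩ := exists_trace_polynomial ι P a
    rw [← hf]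
    exact hg f fun x hx => by simp [hf, hP _ x hx]
  have hlin := (linearIndependent_monoidHom k ℂ).comp
    (fun ρ : k ≃ₐ[ℚ] k => (ι.comp (ρ : k →+* k) : k →* ℂ))
    (fun σ τ h => (comp_galois_bijective ι).1 (RingHom.ext fun a => DFunLike.congr_fun h a))
  rw [Fintype.linearIndependent_iff] at hlin
  exact hlin (fun ρ => P.eval₂ (ι.comp (ρ : k →+* k)) g)
    (by funext a; simpa [Finset.sum_apply, mul_comm] using hsum a) 1

end Descent

namespace AbelianVariety

variable {W : Type*} [NormedAddCommGroup W] [NormedSpace ℂ W] [FiniteDimensional ℂ W]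
  {A : AbelianVariety W} {K : Type*} [Field K] [NumberField K] {i : K →+* A.End0}

/-- The functionals `V_ℂ → ℂ` coming from `V → ℚ` separate points. -/
theorem eq_of_forall_dual {x y : A.H1C} (h : ∀ l : Module.Dual ℚ A.H1,
    TensorProduct.rid ℚ ℂ (LinearMap.baseChange ℂ l x) =
      TensorProduct.rid ℚ ℂ (LinearMap.baseChange ℂ l y)) :
    x = y := by
  let b := Module.finBasis ℚ A.H1
  have key : ∀ (z : A.H1C) j, (b.baseChange ℂ).repr z j =
      TensorProduct.rid ℚ ℂ (LinearMap.baseChange ℂ (b.coord j) z) := by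
    intro z j
    induction z using TensorProduct.induction_on with
    | zero => simp
    | add x y hx hy => simp only [map_add, Finsupp.add_apply, hx, hy]
    | tmul c v => simp
  exact (b.baseChange ℂ).repr.injective (Finsupp.ext fun j => by rw [key, key, h])

/-- Commuting with `K` is a system of linear equations over `ℚ` in the matrix coefficients. -/
theorem commute_iff_matrixCoeff (g : A.GLC) (a : K) :
    Commute (g : Module.End ℂ A.H1C) (A.torusAct i (1 ⊗ₜ a)) ↔
      ∀ (l : Module.Dual ℚ A.H1) (v : A.H1), A.matrixCoeff g (l, A.actH1 (i a) v) =
        A.matrixCoeff g (l ∘ₗ A.actH1 (i a), v) := by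
  have h1 : ∀ (l : Module.Dual ℚ A.H1) (v : A.H1), A.matrixCoeff g (l, A.actH1 (i a) v) =
      TensorProduct.rid ℚ ℂ (LinearMap.baseChange ℂ l ((g.1 * A.torusAct i (1 ⊗ₜ a)) (1 ⊗ₜ v))) := by
    intro l v
    rw [Module.End.mul_apply, torusAct_tmul, one_mul]
    rfl
  have h2 : ∀ (l : Module.Dual ℚ A.H1) (v : A.H1),
      A.matrixCoeff g (l ∘ₗ A.actH1 (i a), v) =
      TensorProduct.rid ℚ ℂ (LinearMap.baseChange ℂ l ((A.torusAct i (1 ⊗ₜ a) * g.1) (1 ⊗ₜ v))) := by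
    intro l v
    have h3 : A.torusAct i (1 ⊗ₜ a) = (A.actH1 (i a)).baseChange ℂ := by
      refine LinearMap.ext fun w => ?_
      induction w using TensorProduct.induction_on with
      | zero => simp
      | add x y hx hy => simp only [map_add, hx, hy]
      | tmul c v => rw [torusAct_tmul, one_mul, LinearMap.baseChange_tmul]
    rw [Module.End.mul_apply, h3, matrixCoeff, LinearMap.baseChange_comp]
    rfl
  simp only [h1, h2]
  refine ⟨fun h l v => by rw [h.eq], fun h => ?_⟩
  refine LinearMap.ext fun w => ?_
  induction w using TensorProduct.induction_on with
  | zero => simp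
  | add x y hx hy => simp only [map_add, hx, hy]
  | tmul c v =>
    have e : (c ⊗ₜ[ℚ] v : A.H1C) = c • (1 ⊗ₜ v) := by simp [TensorProduct.smul_tmul']
    rw [e, map_smul, map_smul, eq_of_forall_dual fun l => h l v]

end AbelianVariety

/-! ### The torus `T₀` is algebraic over `ℚ` -/

theorem prod_zpow_eq_zpow_sum {G I : Type*} [CommGroup G] (s : Finset I) (n : I → ℤ) (a : G) :
    ∏ i ∈ s, a ^ n i = a ^ ∑ i ∈ s, n i := by
  classical
  induction s using Finset.induction_on with
  | empty => simp
  | insert i s hi ih => rw [Finset.prod_insert hi, Finset.sum_insert hi, zpow_add, ih]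

/-- The evaluation at `φ` of an element of `ℂ ⊗ K`, in terms of its coordinates in a `ℚ`-basis of
`K`. -/
theorem tensorEval_eq_sum {K : Type*} [Field K] [NumberField K] {n : Type*} [Fintype n]
    (b : Module.Basis n ℚ K) (φ : K →+* ℂ) (y : ℂ ⊗[ℚ] K) :
    tensorEval φ y = ∑ j, φ (b j) * TensorProduct.rid ℚ ℂ ((b.coord j).lTensor ℂ y) := by
  induction y with
  | zero => simp
  | add x y hx hy => simp only [map_add, hx, hy, mul_add, Finset.sum_add_distrib]
  | tmul z a =>
    conv_lhs => rw [← b.sum_repr a]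
    simp only [TensorProduct.tmul_sum, map_sum, tensorEval_tmul, LinearMap.lTensor_tmul,
      TensorProduct.rid_tmul, Module.Basis.coord_apply]
    refine Finset.sum_congr rfl fun j _ => ?_
    rw [Algebra.smul_def, Algebra.smul_def, map_mul, eq_ratCast, map_ratCast, eq_ratCast]
    ring

section ReflexNorm

variable {K k : Type*} [Field K] [NumberField K] [Field k] [NumberField k] [Algebra K k]
  [IsGalois ℚ k] (ι : k →+* ℂ) (Φ : Finset (K →+* ℂ))

open scoped Classical

/-- Let `c` be a character of `T^K`, the embedding `φ` being extended to `ι ∘ σ φ`, whose pull-back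
along `ψ` is trivial.  Then all the Galois translates of `c` are trivial on `T₀`. -/
theorem prod_torusEquiv_reflexNorm_zpow (σ : (K →+* ℂ) → (k ≃ₐ[ℚ] k)) (c : (K →+* ℂ) → ℤ)
    (hc : ∀ τ : k ≃ₐ[ℚ] k, ∑ φ, c φ *
      (if τ⁻¹ * σ φ ∈ extendedType ι Φ then 1 else 0 : ℤ) = 0)
    (ρ : k ≃ₐ[ℚ] k) (x : Torus k ℂ) :
    ∏ φ, torusEquiv K (reflexNorm ℂ ι Φ x)
      ((ι.comp ((ρ * σ φ : k ≃ₐ[ℚ] k) : k →+* k)).comp (algebraMap K k)) ^ c φ = 1 := by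
  have h : ∀ φ, torusEquiv K (reflexNorm ℂ ι Φ x)
      ((ι.comp ((ρ * σ φ : k ≃ₐ[ℚ] k) : k →+* k)).comp (algebraMap K k)) =
      ∏ τ : k ≃ₐ[ℚ] k, torusEquiv k x (ι.comp ((ρ * τ : k ≃ₐ[ℚ] k) : k →+* k)) ^
        (if τ⁻¹ * σ φ ∈ extendedType ι Φ then 1 else 0 : ℤ) := by
    intro φ
    rw [torusEquiv_reflexNorm, ← Equiv.prod_comp (Equiv.mulLeft ρ)]
    simp only [Equiv.coe_mulLeft, mul_inv_rev, mul_assoc, inv_mul_cancel_left]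
  simp only [h, ← Finset.prod_zpow, ← zpow_mul]
  rw [Finset.prod_comm]
  refine Finset.prod_eq_one fun τ _ => ?_
  rw [prod_zpow_eq_zpow_sum]
  simp only [mul_comm _ (c _), hc, zpow_zero]

/-- A point of `T^K` lies on `T₀` as soon as it is killed by all the characters of `T^K` whose
pull-back along `ψ` is trivial. -/
theorem mem_imageTorus_of_relations (σ : (K →+* ℂ) → (k ≃ₐ[ℚ] k))
    (hσ : ∀ φ, (ι.comp (σ φ : k →+* k)).comp (algebraMap K k) = φ) (y : Torus K ℂ)
    (h : ∀ c : (K →+* ℂ) → ℤ, (∀ τ : k ≃ₐ[ℚ] k, ∑ φ, c φ *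
      (if τ⁻¹ * σ φ ∈ extendedType ι Φ then 1 else 0 : ℤ) = 0) →
        ∏ φ, torusEquiv K y φ ^ c φ = 1) :
    y ∈ imageTorus ι Φ := by
  obtain ⟨x, hx⟩ := exists_eq_prod_zpow _ _ h
  let e := Equiv.ofBijective _ (comp_galois_bijective ι)
  refine ⟨(torusEquiv k).symm fun ψ => x (e.symm ψ), (torusEquiv K).injective (funext fun φ => ?_)⟩
  have he : ∀ ρ : k ≃ₐ[ℚ] k, e.symm (ι.comp (ρ : k →+* k)) = ρ := e.symm_apply_apply
  rw [hx]
  conv_lhs => rw [← hσ φ, torusEquiv_reflexNorm]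
  simp only [MulEquiv.apply_symm_apply, he]

end ReflexNorm

namespace AbelianVariety

variable {W : Type*} [NormedAddCommGroup W] [NormedSpace ℂ W] [FiniteDimensional ℂ W]
  {A : AbelianVariety W}
  {K k : Type*} [Field K] [NumberField K] [Field k] [NumberField k] [Algebra K k]
  [IsGalois ℚ k] (ι : k →+* ℂ) {i : K →+* A.End0} {Φ : Finset (K →+* ℂ)}

omit [Algebra K k] [IsGalois ℚ k] [NumberField k] in
/-- On `T^K`, the character at an embedding `τ` of `K` into `k` is a linear form over `k` in the
matrix coefficients. -/
theorem exists_linearForm {v : A.H1} (hv : Function.Bijective fun a : K => A.actH1 (i a) v)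
    (τ : K →+* k) : ∃ P : MvPolynomial (Module.Dual ℚ A.H1 × A.H1) k,
      ∀ (f : k →+* ℂ) (y : Torus K ℂ),
        P.eval₂ f (A.matrixCoeff (A.torusToGL i y)) = torusEquiv K y (f.comp τ) := by
  let b := Module.finBasis ℚ K
  let l := fun j => b.coord j ∘ₗ (A.cyclicEquiv i hv).symm.toLinearMap
  refine ⟨∑ j, MvPolynomial.C (τ (b j)) * MvPolynomial.X (l j, v), fun f y => ?_⟩
  have hl : ∀ j, l j ∘ₗ (LinearMap.applyₗ v).comp (A.actH1.comp i.toRatAlgHom).toLinearMap =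
      b.coord j := fun j => LinearMap.ext fun a =>
    congrArg (b.coord j) ((A.cyclicEquiv i hv).symm_apply_apply a)
  rw [torusEquiv_apply, tensorEval_eq_sum b, MvPolynomial.eval₂_sum]
  simp only [MvPolynomial.eval₂_mul, MvPolynomial.eval₂_C, MvPolynomial.eval₂_X,
    matrixCoeff_torusToGL, hl, RingHom.comp_apply]

/-- `T₀` is an algebraic `ℚ`-subgroup of `GL(V)`: it is the locus of all the rational equations
which hold on it. -/
theorem isAlgebraicSubgroup_map_imageTorus {v : A.H1}
    (hv : Function.Bijective fun a : K => A.actH1 (i a) v) :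
    A.IsAlgebraicSubgroup ((imageTorus ι Φ).map (A.torusToGL i)) := by
  classical
  set T := (imageTorus ι Φ).map (A.torusToGL i)
  refine ⟨{f | ∀ t ∈ T, MvPolynomial.aeval (A.matrixCoeff t) f = 0}, fun g =>
    ⟨fun hg f hf => hf g hg, fun hg => ?_⟩⟩
  -- The equations expressing that `g` commutes with `K` put `g` into `T^K`.
  have hcomm : ∀ a : K, Commute (g : Module.End ℂ A.H1C) (A.torusAct i (1 ⊗ₜ a)) := by
    intro a
    refine (commute_iff_matrixCoeff g a).2 fun l w => sub_eq_zero.1 ?_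
    have := hg (MvPolynomial.X (l, A.actH1 (i a) w) - MvPolynomial.X (l ∘ₗ A.actH1 (i a), w)) (by
      rintro _ ⟨y, -, rfl⟩
      have h : Commute (A.torusAct i y.1) (A.torusAct i (1 ⊗ₜ a)) := (Commute.all _ _).map _
      simpa using sub_eq_zero.2 ((commute_iff_matrixCoeff (A.torusToGL i y) a).1 h l w))
    simpa using this
  obtain ⟨y, rfl⟩ := A.mem_range_torusToGL i hv g hcomm
  choose σ hσ using exists_comp_galois_eq (K := K) ι
  refine ⟨y, mem_imageTorus_of_relations ι Φ σ hσ y fun c hc => ?_, rfl⟩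
  choose P hP using fun φ => exists_linearForm (k := k) hv ((σ φ : k →+* k).comp (algebraMap K k))
  -- The equation `∏ φ ^ c φ = 1` without denominators: the positive exponents against the negative
  -- ones.
  let Q : MvPolynomial (Module.Dual ℚ A.H1 × A.H1) k :=
    ∏ φ, P φ ^ (c φ).toNat - ∏ φ, P φ ^ (-c φ).toNat
  have hQ : ∀ (ρ : k ≃ₐ[ℚ] k) (y : Torus K ℂ),
      Q.eval₂ (ι.comp (ρ : k →+* k)) (A.matrixCoeff (A.torusToGL i y)) = 0 ↔
      ∏ φ, torusEquiv K y ((ι.comp ((ρ * σ φ : k ≃ₐ[ℚ] k) : k →+* k)).comp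
        (algebraMap K k)) ^ c φ = 1 := by
    intro ρ y
    have h1 : ∀ φ, (P φ).eval₂ (ι.comp (ρ : k →+* k)) (A.matrixCoeff (A.torusToGL i y)) =
        torusEquiv K y ((ι.comp ((ρ * σ φ : k ≃ₐ[ℚ] k) : k →+* k)).comp (algebraMap K k)) :=
      fun φ => hP φ _ y
    have h2 : ∀ (u : ℂˣ) (m : ℤ), u ^ m = u ^ m.toNat / u ^ (-m).toNat := fun u m => by
      rw [← zpow_natCast, ← zpow_natCast, div_eq_mul_inv, ← zpow_sub, Int.toNat_sub_toNat_neg]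
    simp only [h2, Finset.prod_div_distrib, div_eq_one, ← Units.val_inj, Units.coe_prod,
      Units.val_pow_eq_pow_val, ← h1]
    simp only [Q, MvPolynomial.eval₂_sub, MvPolynomial.eval₂_prod, MvPolynomial.eval₂_pow,
      sub_eq_zero]
  have hQ1 := eval₂_eq_zero_of_descent ι (A.matrixCoeff '' T)
    (A.matrixCoeff (A.torusToGL i y))
    (fun f hf => hg f fun t ht => hf _ ⟨t, ht, rfl⟩) Q (by
      rintro ρ _ ⟨_, ⟨_, ⟨x, rfl⟩, rfl⟩, rfl⟩
      exact (hQ ρ _).2 (prod_torusEquiv_reflexNorm_zpow ι Φ σ c hc ρ x))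
  have hfin := (hQ 1 y).1 hQ1
  simpa only [one_mul, hσ] using hfin

end AbelianVariety

end CMAV

end

theorem lemma4p2
    {W : Type*} [NormedAddCommGroup W] [NormedSpace ℂ W] [FiniteDimensional ℂ W]
    (A : CMAV.AbelianVariety W)
    {K k : Type*} [Field K] [NumberField K] [Field k] [NumberField k]
    [Algebra K k] [IsGalois ℚ k] (ι : k →+* ℂ)
    (i : K →+* A.End0) (Φ : Finset (K →+* ℂ)) (hA : A.IsOfCMType i Φ) :
    A.mumfordTate = (CMAV.imageTorus ι Φ).map (A.torusToGL i) := by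
  obtain ⟨v, hv⟩ := A.exists_cyclic_vector i hA.two_mul_dim
  refine le_antisymm (A.isLeast_mumfordTate.2 ⟨A.isAlgebraicSubgroup_map_imageTorus ι hv, ?_⟩)
    (hA.map_imageTorus_le ι)
  rintro _ ⟨z, rfl⟩
  exact ⟨_, ⟨_, rfl⟩, (hA.hodgeCochar_eq ι z).symm⟩
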